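/- Let $P$ be a finite poset with covering relation $\prec$. Let $P^*\subseteq P$ be a set of marked elements containing all minimal and all maximal elements of $P$, let $\lambda\colon P^*\to\mathbb R$ be an order-preserving map (the marking) with values in $\mathbb Z$, and put $\tilde P=P\setminus P^*$. Assume that the marked poset $(P,\lambda)$ is regular: for every covering relation $p\prec q$ in $P$ and all $a,b\in P^*$ with $a\le q$ and $p\le b$, either $a=b$ or $\lambda(a)<\lambda(b)$. For a partition $\tilde P=C\sqcup O$ (either part may be empty), the marked chain-order polytope $\mathcal O_{C,O}(P,\lambda)$ is the set of all $x\in\mathbb R^{P}$ such that 1. $x_a=\lambda(a)$ for all $a\in P^*$; 2. $x_p\ge 0$ for all $p\in C$; 3. $x_{p_1}+\dots+x_{p_k}\le x_b-x_a$ for every saturated chain $a\prec p_1\prec\dots\prec p_k\prec b$ with $a,b\in P^*\sqcup O$, $p_1,\dots,p_k\in C$ and $k\ge 0$. As its coordinates in $P^*$ are fixed, it is regarded, by projection, as a subset of $\mathbb R^{\tilde P}$; its interior and its lattice points are those in $\mathbb R^{\tilde P}$ with the lattice $\mathbb Z^{\tilde P}$. A polytope $Q\subseteq\mathbb R^{\tilde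 P}$ with $0$ in its interior is reflexive if both $Q$ and its polar dual $Q^\circ=\{\alpha\in(\mathbb R^{\tilde P})^*\mid \alpha(x)\le 1\text{ for all }x\in Q\}$ are lattice polytopes, that is, convex hulls of finitely many points of $\mathbb Z^{\tilde P}$ and of its dual lattice, respectively. Then the following are equivalent: (i) there is a function $r\colon P\to\mathbb Z$ with $r(p)=r(q)-1$ for every covering relation $p\prec q$ in $P$ (a rank function, so that $P$ is ranked) such that $\lambda(a)=r(a)$ for all $a\in P^*$; (ii) for every partition $\tilde P=C\sqcup O$, the polytope $\mathcal O_{C,O}(P,\lambda)\subseteq\mathbb R^{\tilde P}$ has a unique interior lattice point $u$, and the translated polytope $\mathcal O_{C,O}(P,\lambda)-u$ is reflexive. -/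

import Mathlib

/-- A marked poset structure on `P`: a set of marked elements (with the induced order) and an
order-preserving real marking on it. -/
structure MarkedPoset (P : Type*) [PartialOrder P] where
  marked : Set P
  marking : marked → ℝ
  monotone_marking : Monotone marking

namespace MarkedPoset

variable {P : Type*} [PartialOrder P]

/-- The type of unmarked elements. -/
abbrev Unmarked (M : MarkedPoset P) : Type _ := {p : P // p ∉ M.marked}

/-- The marking takes only integer values. -/
def IsIntegral (M : MarkedPoset P) : Prop :=
  ∀ a : M.marked, ∃ n : ℤ, M.marking a = (n : ℝ)

/-- Regularity of a marked poset. -/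
def IsRegular (M : MarkedPoset P) : Prop :=
  ∀ p q : P, p ⋖ q → ∀ a b : M.marked, (a : P) ≤ q → p ≤ (b : P) →
    a = b ∨ M.marking a < M.marking b

/-- The marked chain-order polyhedron in `ℝ^P` for the chain elements `C` and the order
elements `O`. The list `l` in the last condition is the (possibly empty) sequence of chain
elements strictly between the ends `a` and `b` of a saturated chain. -/
def chainOrderPolyhedron (M : MarkedPoset P) (C O : Set P) : Set (P → ℝ) :=
  {x | (∀ a : M.marked, x a = M.marking a) ∧
    (∀ p ∈ C, 0 ≤ x p) ∧
    (∀ (a b : P) (l : List P), a ∈ M.marked ∪ O → b ∈ M.marked ∪ O → (∀ p ∈ l, p ∈ C) →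
      List.IsChain (fun p q => p ⋖ q) (a :: (l ++ [b])) →
      (l.map x).sum ≤ x b - x a)}

/-- The projection of the marked chain-order polyhedron to the coordinates of the unmarked
elements. -/
def chainOrderPolytope (M : MarkedPoset P) (C O : Set P) : Set (M.Unmarked → ℝ) :=
  Set.image (fun (x : P → ℝ) (p : M.Unmarked) => x p) (M.chainOrderPolyhedron C O)

end MarkedPoset

/-- A rank function on a poset. -/
def IsRankFunction {P : Type*} [PartialOrder P] (r : P → ℤ) : Prop :=
  ∀ p q : P, p ⋖ q → r p = r q - 1

/-- The lattice `ℤ^ι` in `ℝ^ι`. -/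
def latticePoints (ι : Type*) : Set (ι → ℝ) :=
  {x | ∀ i, ∃ n : ℤ, x i = (n : ℝ)}

/-- The dual lattice of `ℤ^ι` in the dual space of `ℝ^ι`. -/
def dualLatticePoints (ι : Type*) : Set (Module.Dual ℝ (ι → ℝ)) :=
  {α | ∀ x ∈ latticePoints ι, ∃ n : ℤ, α x = (n : ℝ)}

/-- `Q` is a lattice polytope with respect to the lattice `L`: the convex hull of finitely many
points of `L`. -/
def IsLatticePolytope {E : Type*} [AddCommGroup E] [Module ℝ E] (L Q : Set E) : Prop :=
  ∃ s : Set E, s.Finite ∧ s ⊆ L ∧ Q = convexHull ℝ s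

/-- The polar dual of a subset of `ℝ^ι`, in the dual space. -/
def polarDual {ι : Type*} (Q : Set (ι → ℝ)) : Set (Module.Dual ℝ (ι → ℝ)) :=
  {α | ∀ x ∈ Q, α x ≤ 1}

/-- `Q` is a reflexive polytope: the origin is an interior point, and both `Q` and its polar
dual are lattice polytopes. -/
def IsReflexivePolytope {ι : Type*} (Q : Set (ι → ℝ)) : Prop :=
  0 ∈ interior Q ∧ IsLatticePolytope (latticePoints ι) Q ∧
    IsLatticePolytope (dualLatticePoints ι) (polarDual Q)

/-! From (i) to (ii), let `u` be `1` on `C` and `r` elsewhere. A saturated chain with `k` inner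
elements in `C` has rank difference `k + 1`, so every defining inequality has slack exactly `1` at
`u` (`image_sub_rankPoint`). The translate is thus cut out by finitely many integral functionals `α
≤ 1`. Its polar is the hull of these and `0`, and boundedness leaves `0` as its only interior
lattice point.

That the polytope itself is a lattice polytope holds for any integral marking. A transfer map turns
`x` into an order-preserving extension `y` of the marking. The roundings `⌊y + t⌋`, `t` uniform in
`[0, 1)`, are order-preserving integral extensions with mean `y`, and transferring them back
exhibits `x` as a mean of lattice points (`chainOrderPolytope_eq_convexHull`).

From (ii) to (i), the order polytope (`C = ∅`) suffices. Regularity makes each covering relation a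
facet (`exists_tight_only_at`). A dual lattice point supporting the facet is an integral multiple of
its primitive normal, so reflexivity puts the facet at lattice distance `1` from `u`
(`sub_eq_one_of_reflexive`). Hence `u` together with the marking is a rank function. -/

/-! ### Averages of floors and lattice points -/

open MeasureTheory in
theorem integral_floor_add (y : ℝ) : ∫ t in (0 : ℝ)..1, ((⌊y + t⌋ : ℤ) : ℝ) = y := by
  have hmono : Monotone fun s : ℝ => ((⌊s⌋ : ℤ) : ℝ) := fun a b h =>
    Int.cast_le.2 (Int.floor_mono h)
  have hfloor : ∀ a b, IntervalIntegrable (fun s : ℝ => ((⌊s⌋ : ℤ) : ℝ)) volume a b :=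
    fun a b => hmono.intervalIntegrable
  -- The identity has mean `y + 1/2` on `[y, y + 1]`; the fractional part removes the `1/2`.
  have hfract : ∫ s in y..(y + 1), Int.fract s = 1 / 2 := by
    have hper : Function.Periodic (fun s : ℝ => Int.fract s) 1 := fun s => Int.fract_add_one s
    rw [hper.intervalIntegral_add_eq y 0, zero_add]
    rw [intervalIntegral.integral_congr_Ioo_of_le (g := fun s => s) zero_le_one]
    · simp
    · intro s hs
      exact Int.fract_eq_self.2 ⟨hs.1.le, hs.2⟩
  have hcomp : ∫ t in (0 : ℝ)..1, ((⌊y + t⌋ : ℤ) : ℝ) = ∫ s in y..(y + 1), ((⌊s⌋ : ℤ) : ℝ) := by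
    rw [intervalIntegral.integral_comp_add_left (fun s : ℝ => ((⌊s⌋ : ℤ) : ℝ)), add_zero]
  have hsub : ∫ s in y..(y + 1), Int.fract s
      = (∫ s in y..(y + 1), s) - ∫ s in y..(y + 1), ((⌊s⌋ : ℤ) : ℝ) := by
    rw [← intervalIntegral.integral_sub intervalIntegral.intervalIntegrable_id (hfloor _ _)]
    rfl
  rw [hcomp]
  rw [integral_id] at hsub
  linarith

theorem finite_latticePoints_inter {ι : Type*} [Finite ι] {Q : Set (ι → ℝ)} {B : ℝ}
    (hB : ∀ x ∈ Q, ∀ i, |x i| ≤ B) : (Q ∩ latticePoints ι).Finite := by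
  have hfin : (Set.pi Set.univ fun _ : ι => ((fun n : ℤ => (n : ℝ)) '' Set.Icc (-⌈B⌉) ⌈B⌉)).Finite :=
    Set.Finite.pi fun _ => (Set.finite_Icc _ _).image _
  refine hfin.subset fun x hx i _ => ?_
  obtain ⟨n, hn⟩ := hx.2 i
  have h := abs_le.1 ((hB x hx.1 i).trans (Int.le_ceil B))
  rw [hn] at h
  exact ⟨n, ⟨by exact_mod_cast h.1, by exact_mod_cast h.2⟩, hn.symm⟩

theorem dualLatticePoints.zero_mem (ι : Type*) : (0 : Module.Dual ℝ (ι → ℝ)) ∈ dualLatticePoints ι :=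
  fun _ _ => ⟨0, by simp⟩

theorem dualLatticePoints.add_mem {ι : Type*} {α β : Module.Dual ℝ (ι → ℝ)}
    (hα : α ∈ dualLatticePoints ι) (hβ : β ∈ dualLatticePoints ι) :
    α + β ∈ dualLatticePoints ι := fun x hx => by
  obtain ⟨m, hm⟩ := hα x hx
  obtain ⟨n, hn⟩ := hβ x hx
  exact ⟨m + n, by simp [hm, hn]⟩

theorem dualLatticePoints.neg_mem {ι : Type*} {α : Module.Dual ℝ (ι → ℝ)}
    (hα : α ∈ dualLatticePoints ι) : -α ∈ dualLatticePoints ι := fun x hx => by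
  obtain ⟨m, hm⟩ := hα x hx
  exact ⟨-m, by simp [hm]⟩

/-! ### Polyhedra at lattice distance one and their polars -/

/-- The polyhedron of points at which all functionals in `K` are at most `1`. -/
def unitPolyhedron {ι : Type*} (K : Set (Module.Dual ℝ (ι → ℝ))) : Set (ι → ℝ) :=
  {w | ∀ α ∈ K, α w ≤ 1}

/-- Some `t • w` with `t > 1` stays inside, so the integer `α w` is less than `1`, hence `≤ 0`, for
all `α ∈ K`. The whole ray through `w` then lies in a bounded set. -/
theorem eq_zero_of_mem_interior_unitPolyhedron {ι : Type*}
    {K : Set (Module.Dual ℝ (ι → ℝ))} (hlat : K ⊆ dualLatticePoints ι) {B : ℝ}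
    (hB : ∀ w ∈ unitPolyhedron K, ∀ i, |w i| ≤ B) {w : ι → ℝ}
    (hw : w ∈ interior (unitPolyhedron K)) (hwl : w ∈ latticePoints ι) : w = 0 := by
  have hcont : Filter.Tendsto (fun t : ℝ => t • w) (nhds 1) (nhds w) := by
    simpa using (Continuous.tendsto (f := fun t : ℝ => t • w) (by fun_prop) 1)
  have hev : ∀ᶠ t in nhdsWithin (1 : ℝ) (Set.Ioi 1), t • w ∈ unitPolyhedron K :=
    (hcont.eventually (mem_interior_iff_mem_nhds.1 hw)).filter_mono nhdsWithin_le_nhds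
  obtain ⟨t, htw, ht⟩ := (hev.and self_mem_nhdsWithin).exists
  have hnonpos : ∀ α ∈ K, α w ≤ 0 := fun α hα => by
    obtain ⟨n, hn⟩ := hlat hα w hwl
    have h := htw α hα
    rw [map_smul, smul_eq_mul, hn] at h
    rw [hn]
    have hlt : n < 1 := by
      by_contra! hge
      have : (1 : ℝ) ≤ n := by exact_mod_cast hge
      have ht' : (1 : ℝ) < t := ht
      nlinarith
    exact_mod_cast (by lia : n ≤ 0)
  have hmul : ∀ s : ℝ, 0 ≤ s → s • w ∈ unitPolyhedron K := fun s hs α hα => by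
    rw [map_smul, smul_eq_mul]
    linarith [mul_nonpos_of_nonneg_of_nonpos hs (hnonpos α hα)]
  funext i
  by_contra hne
  have hpos : 0 < |w i| := abs_pos.2 hne
  have hB0 : 0 ≤ B := (abs_nonneg _).trans (hB _ (hmul 0 le_rfl) i)
  have h := hB _ (hmul ((B + 1) / |w i|) (by positivity)) i
  rw [Pi.smul_apply, smul_eq_mul, abs_mul, abs_of_nonneg (by positivity : 0 ≤ (B + 1) / |w i|),
    div_mul_cancel₀ _ hpos.ne'] at h
  linarith

section
variable {ι : Type*} [Finite ι] {K : Set (Module.Dual ℝ (ι → ℝ))}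

theorem zero_mem_interior_unitPolyhedron (hK : K.Finite) : 0 ∈ interior (unitPolyhedron K) := by
  have hopen : IsOpen (⋂ α ∈ K, {w : ι → ℝ | α w < 1}) :=
    hK.isOpen_biInter fun α _ =>
      isOpen_lt (LinearMap.continuous_of_finiteDimensional α) continuous_const
  refine interior_maximal (fun w hw α hα => ?_) hopen ?_
  · exact (Set.mem_iInter₂.1 hw α hα).le
  · exact Set.mem_iInter₂.2 fun α _ => by simp

/-- Bipolar argument: a functional `γ` outside the hull is separated from it by evaluation at some
`v` with threshold `s`. As `0` lies in the hull, `s > 0`, and `s⁻¹ • v` is a point of the polyhedron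
with `γ > 1`. -/
theorem polarDual_unitPolyhedron (hK : K.Finite) :
    polarDual (unitPolyhedron K) = convexHull ℝ (insert 0 K) := by
  classical
  have := Fintype.ofFinite ι
  apply Set.Subset.antisymm
  · intro γ hγ
    by_contra hγ'
    -- Separation takes place in `ι → ℝ`, where `κ` records the coefficients of a functional.
    let κ : Module.Dual ℝ (ι → ℝ) →ₗ[ℝ] (ι → ℝ) :=
      LinearMap.pi fun i => LinearMap.applyₗ (fun j => if i = j then (1 : ℝ) else 0)
    have hκ : ∀ (α : Module.Dual ℝ (ι → ℝ)) (x : ι → ℝ), α x = ∑ i, x i * κ α i :=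
      fun α x => LinearMap.pi_apply_eq_sum_univ α x
    have hinj : Function.Injective κ := fun α β h => by
      ext1
      rw [LinearMap.ext_iff]
      intro x
      simp [hκ, h]
    have hclosed : IsClosed (κ '' convexHull ℝ (insert 0 K)) := by
      rw [LinearMap.image_convexHull]
      exact ((hK.insert 0).image κ).isClosed_convexHull ℝ
    obtain ⟨f, s, hs, hγs⟩ := geometric_hahn_banach_closed_point
      ((convex_convexHull ℝ _).linear_image κ) hclosed
      (fun h => hγ' ((hinj.mem_set_image).1 h))
    let v : ι → ℝ := fun i => f fun j => if i = j then 1 else 0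
    have hf : ∀ α : Module.Dual ℝ (ι → ℝ), f (κ α) = α v := fun α => by
      rw [hκ α v]
      refine (LinearMap.pi_apply_eq_sum_univ f.toLinearMap (κ α)).trans ?_
      exact Finset.sum_congr rfl fun i _ => mul_comm _ _
    have hs0 : 0 < s := by
      simpa using hs _ ⟨0, subset_convexHull ℝ _ (Set.mem_insert _ _), rfl⟩
    have hmem : s⁻¹ • v ∈ unitPolyhedron K := fun α hα => by
      have h := hs _ ⟨α, subset_convexHull ℝ _ (Set.mem_insert_of_mem _ hα), rfl⟩
      rw [hf] at h
      rw [map_smul, smul_eq_mul, inv_mul_le_iff₀ hs0, mul_one]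
      exact h.le
    have h := hγ _ hmem
    rw [map_smul, smul_eq_mul, inv_mul_le_iff₀ hs0, mul_one, ← hf] at h
    exact absurd h (not_le.2 hγs)
  · refine convexHull_min ?_ ?_
    · rintro α (rfl | hα) w hw
      · simp
      · exact hw α hα
    · intro α hα β hβ a b ha hb hab w hw
      have h1 := mul_le_mul_of_nonneg_left (hα w hw) ha
      have h2 := mul_le_mul_of_nonneg_left (hβ w hw) hb
      simp only [LinearMap.add_apply, LinearMap.smul_apply, smul_eq_mul]
      linarith

end

theorem image_sub_convexHull {ι : Type*} (S : Set (ι → ℝ)) (u : ι → ℝ) :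
    (fun x => x - u) '' convexHull ℝ S = convexHull ℝ ((fun x => x - u) '' S) := by
  rw [← Set.sub_singleton, ← Set.sub_singleton, convexHull_sub, convexHull_singleton]

theorem interior_image_sub {ι : Type*} (Q : Set (ι → ℝ)) (u : ι → ℝ) :
    interior ((fun x => x - u) '' Q) = (fun x => x - u) '' interior Q :=
  ((Homeomorph.subRight u).image_interior Q).symm

/-- A bounded polytope that is an integral translate of a polyhedron cut out by finitely many
integral inequalities with right hand side `1`, and that is contained in the convex hull of its
lattice points, has a unique interior lattice point and is reflexive after translation. -/
theorem isReflexivePolytope_of_image_sub_eq {ι : Type*} [Finite ι]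
    {K : Set (Module.Dual ℝ (ι → ℝ))} (hK : K.Finite) (hlat : K ⊆ dualLatticePoints ι)
    {Q : Set (ι → ℝ)} {u : ι → ℝ} (hu : u ∈ latticePoints ι)
    (hQ : (fun x => x - u) '' Q = unitPolyhedron K) {B : ℝ} (hB : ∀ x ∈ Q, ∀ i, |x i| ≤ B)
    (hconv : Q = convexHull ℝ (Q ∩ latticePoints ι)) :
    interior Q ∩ latticePoints ι = {u} ∧ IsReflexivePolytope ((fun x => x - u) '' Q) := by
  have hzero := zero_mem_interior_unitPolyhedron hK
  have hsubl : ∀ x ∈ latticePoints ι, x - u ∈ latticePoints ι := fun x hx i => by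
    obtain ⟨m, hm⟩ := hx i
    obtain ⟨n, hn⟩ := hu i
    exact ⟨m - n, by simp [hm, hn]⟩
  have hB' : ∀ w ∈ unitPolyhedron K, ∀ i, |w i| ≤ B + ∑ᶠ j, |u j| := by
    have := Fintype.ofFinite ι
    rw [← hQ]
    rintro _ ⟨x, hx, rfl⟩ i
    rw [finsum_eq_sum_of_fintype]
    have h := Finset.single_le_sum (f := fun j => |u j|) (fun j _ => abs_nonneg _)
      (Finset.mem_univ i)
    exact (abs_sub _ _).trans (add_le_add (hB x hx i) h)
  refine ⟨Set.Subset.antisymm ?_ ?_, ?_, ?_, ?_⟩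
  · rintro x ⟨hx, hxl⟩
    have hxu : x - u ∈ interior (unitPolyhedron K) := by
      rw [← hQ, interior_image_sub]
      exact ⟨x, hx, rfl⟩
    exact sub_eq_zero.1
      (eq_zero_of_mem_interior_unitPolyhedron hlat hB' hxu (hsubl x hxl))
  · rintro _ rfl
    rw [← hQ, interior_image_sub] at hzero
    obtain ⟨x, hx, hxu⟩ := hzero
    rw [← sub_eq_zero.1 hxu]
    exact ⟨hx, by rwa [sub_eq_zero.1 hxu]⟩
  · rwa [hQ]
  · refine ⟨(fun x => x - u) '' (Q ∩ latticePoints ι), (finite_latticePoints_inter hB).image _, ?_,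
      ?_⟩
    · rintro _ ⟨x, hx, rfl⟩
      exact hsubl x hx.2
    · rw [← image_sub_convexHull, ← hconv]
  · refine ⟨insert 0 K, hK.insert 0, Set.insert_subset (dualLatticePoints.zero_mem ι) hlat, ?_⟩
    rw [hQ, polarDual_unitPolyhedron hK]

/-! ### Transfer to order-preserving extensions -/

theorem monotone_of_covBy {P : Type*} [PartialOrder P] [Finite P] {f : P → ℝ}
    (h : ∀ p q, p ⋖ q → f p ≤ f q) : Monotone f := by
  classical
  have := Fintype.ofFinite P
  let := Fintype.toLocallyFiniteOrder (α := P)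
  exact (monotone_iff_forall_covBy f).2 fun p q hpq => h p q hpq

theorem exists_isMin_le {P : Type*} [PartialOrder P] [Finite P] (p : P) : ∃ a, a ≤ p ∧ IsMin a := by
  obtain ⟨a, ha, hmin⟩ := (Set.toFinite (Set.Iic p)).exists_le_minimal (a := p) le_rfl
  exact ⟨a, ha, fun b hb => hmin.2 (hb.trans ha) hb⟩

theorem exists_isMax_ge {P : Type*} [PartialOrder P] [Finite P] (p : P) : ∃ b, p ≤ b ∧ IsMax b := by
  obtain ⟨a, ha, hmax⟩ := (Set.toFinite (Set.Ici p)).exists_le_maximal (a := p) le_rfl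
  exact ⟨a, ha, fun b hb => hmax.2 (ha.trans hb) hb⟩

/-- `m` chooses for every element of `C` a lower cover at which `y` is maximal. -/
def IsMaxLowerCover {P : Type*} [PartialOrder P] (C : Set P) (y : P → ℝ) (m : P → P) : Prop :=
  ∀ p ∈ C, m p ⋖ p ∧ ∀ q, q ⋖ p → y q ≤ y (m p)

open Classical in
/-- The inverse transfer map: subtract on `C` the value at the chosen lower cover. -/
noncomputable def inverseTransfer {P : Type*} (C : Set P) (m : P → P) (y : P → ℝ) : P → ℝ :=
  fun p => if p ∈ C then y p - y (m p) else y p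

theorem inverseTransfer_of_mem {P : Type*} {C : Set P} {m : P → P} {y : P → ℝ} {p : P}
    (hp : p ∈ C) : inverseTransfer C m y p = y p - y (m p) := if_pos hp

theorem inverseTransfer_of_notMem {P : Type*} {C : Set P} {m : P → P} {y : P → ℝ} {p : P}
    (hp : p ∉ C) : inverseTransfer C m y p = y p := if_neg hp

/-- Well-founded recursion: on `C`, `y p` is `x p` plus the maximum of `y` over the lower covers of
`p`; `m p` attains this maximum. -/
theorem exists_transfer {P : Type*} [PartialOrder P] [Finite P] {C : Set P}
    (hC : ∀ p ∈ C, ¬ IsMin p) (x : P → ℝ) :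
    ∃ (y : P → ℝ) (m : P → P), IsMaxLowerCover C y m ∧ inverseTransfer C m y = x := by
  classical
  let F : (p : P) → ((q : P) → q < p → ℝ) → ℝ := fun p ih =>
    if p ∈ C then x p + ⨆ q : {q : P // q ⋖ p}, ih q q.2.lt else x p
  let y : P → ℝ := (wellFounded_lt (α := P)).fix F
  have hy : ∀ p, y p = if p ∈ C then x p + ⨆ q : {q : P // q ⋖ p}, y q else x p :=
    fun p => WellFounded.fix_eq _ F p
  have hex : ∀ p, ∃ m, p ∈ C → (m ⋖ p ∧ ∀ q, q ⋖ p → y q ≤ y m) ∧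
      y m = ⨆ q : {q : P // q ⋖ p}, y q := fun p => by
    by_cases hp : p ∈ C
    · obtain ⟨q₀, hq₀⟩ := exists_covBy_of_wellFoundedGT (hC p hp)
      have : Nonempty {q : P // q ⋖ p} := ⟨⟨q₀, hq₀⟩⟩
      obtain ⟨m, hm⟩ := exists_eq_ciSup_of_finite (f := fun q : {q : P // q ⋖ p} => y q)
      refine ⟨m, fun _ => ⟨⟨m.2, fun q hq => ?_⟩, hm⟩⟩
      rw [hm]
      exact le_ciSup (f := fun q : {q : P // q ⋖ p} => y q) (Set.finite_range _).bddAbove ⟨q, hq⟩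
    · exact ⟨p, fun h => absurd h hp⟩
  choose m hm using hex
  refine ⟨y, m, fun p hp => (hm p hp).1, funext fun p => ?_⟩
  by_cases hp : p ∈ C
  · rw [inverseTransfer_of_mem hp, hy p, if_pos hp, (hm p hp).2]
    ring
  · rw [inverseTransfer_of_notMem hp, hy p, if_neg hp]

namespace MarkedPoset

variable {P : Type*} [PartialOrder P] {M : MarkedPoset P} {C O : Set P} {x y : P → ℝ} {m : P → P}

/-- While the lower end lies in `C`, the chain is prolonged downwards by `m`, which leaves the left
side unchanged. Once it leaves `C`, the claim is a defining inequality. -/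
theorem transfer_add_sum_le [Finite P]
    (hCO : ∀ p, p ∉ C ↔ p ∈ M.marked ∪ O) (hx : x ∈ M.chainOrderPolyhedron C O)
    (hm : IsMaxLowerCover C y m) (hy : inverseTransfer C m y = x) (p b : P) (l : List P)
    (hb : b ∉ C) (hl : ∀ q ∈ l, q ∈ C)
    (hch : List.IsChain (fun p q => p ⋖ q) (p :: (l ++ [b]))) : y p + (l.map x).sum ≤ x b := by
  induction p using (wellFounded_lt (α := P)).induction generalizing l with
  | _ p ih =>
    by_cases hp : p ∈ C
    · have h := ih (m p) (hm p hp).1.lt (p :: l)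
        (fun q hq => (List.mem_cons.1 hq).elim (fun h => h ▸ hp) (hl q))
        (List.isChain_cons_cons.2 ⟨(hm p hp).1, hch⟩)
      have hxp : x p = y p - y (m p) := by rw [← hy, inverseTransfer_of_mem hp]
      rw [List.map_cons, List.sum_cons] at h
      linarith
    · have h := hx.2.2 p b l ((hCO p).1 hp) ((hCO b).1 hb) hl hch
      have hxp : x p = y p := by rw [← hy, inverseTransfer_of_notMem hp]
      linarith

theorem monotone_transfer [Finite P]
    (hCO : ∀ p, p ∉ C ↔ p ∈ M.marked ∪ O) (hx : x ∈ M.chainOrderPolyhedron C O)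
    (hm : IsMaxLowerCover C y m) (hy : inverseTransfer C m y = x) : Monotone y := by
  refine monotone_of_covBy fun p q hpq => ?_
  by_cases hq : q ∈ C
  · have h := hx.2.1 q hq
    rw [← hy, inverseTransfer_of_mem hq] at h
    linarith [(hm q hq).2 p hpq]
  · have h := M.transfer_add_sum_le hCO hx hm hy p q [] hq (by simp) (by simpa using hpq)
    rw [← hy, inverseTransfer_of_notMem hq] at h
    simpa using h

/-- Along a chain, the value at `c ∈ C` is at most `y c` minus `y` at the predecessor, so the sum
telescopes. -/
theorem inverseTransfer_mem
    (hCO : ∀ p, p ∉ C ↔ p ∈ M.marked ∪ O) (hm : IsMaxLowerCover C y m) (hy : Monotone y)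
    (hmark : ∀ a : M.marked, y a = M.marking a) :
    inverseTransfer C m y ∈ M.chainOrderPolyhedron C O := by
  have hchain : ∀ (b : P) (l : List P) (a : P), (∀ q ∈ l, q ∈ C) →
      List.IsChain (fun p q => p ⋖ q) (a :: (l ++ [b])) →
      (l.map (inverseTransfer C m y)).sum ≤ y b - y a := by
    intro b l
    induction l with
    | nil =>
      intro a _ hch
      simpa using hy (by simpa using hch : a ⋖ b).le
    | cons c l ih =>
      intro a hl hch
      rw [List.cons_append, List.isChain_cons_cons] at hch
      have hc : c ∈ C := hl c (by simp)
      have h := ih c (fun q hq => hl q (by simp [hq])) hch.2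
      rw [List.map_cons, List.sum_cons, inverseTransfer_of_mem hc]
      linarith [(hm c hc).2 a hch.1]
  refine ⟨fun a => ?_, fun p hp => ?_, fun a b l ha hb hl hch => ?_⟩
  · rw [inverseTransfer_of_notMem ((hCO a).2 (Or.inl a.2)), hmark]
  · rw [inverseTransfer_of_mem hp]
    exact sub_nonneg.2 (hy (hm p hp).1.le)
  · rw [inverseTransfer_of_notMem ((hCO a).2 ha), inverseTransfer_of_notMem ((hCO b).2 hb)]
    exact hchain b l a hl hch

theorem exists_monotone_transfer [Finite P]
    (hCO : ∀ p, p ∉ C ↔ p ∈ M.marked ∪ O) (hmin : ∀ p : P, IsMin p → p ∈ M.marked)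
    (hx : x ∈ M.chainOrderPolyhedron C O) : ∃ (y : P → ℝ) (m : P → P), IsMaxLowerCover C y m ∧
      inverseTransfer C m y = x ∧ Monotone y ∧ ∀ a : M.marked, y a = M.marking a := by
  obtain ⟨y, m, hm, hy⟩ :=
    exists_transfer (C := C) (fun p hp h => (hCO p).2 (Or.inl (hmin p h)) hp) x
  refine ⟨y, m, hm, hy, M.monotone_transfer hCO hx hm hy, fun a => ?_⟩
  rw [← hx.1 a, ← hy, inverseTransfer_of_notMem ((hCO a).2 (Or.inl a.2))]

theorem exists_forall_abs_le [Finite P]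
    (hCO : ∀ p, p ∉ C ↔ p ∈ M.marked ∪ O) (hmin : ∀ p : P, IsMin p → p ∈ M.marked)
    (hmax : ∀ p : P, IsMax p → p ∈ M.marked) :
    ∃ B : ℝ, ∀ x ∈ M.chainOrderPolyhedron C O, ∀ p, |x p| ≤ B := by
  obtain ⟨B, hB⟩ := (Set.finite_range fun a : M.marked => |M.marking a|).bddAbove
  have hB' : ∀ a, |M.marking a| ≤ B := fun a => hB ⟨a, rfl⟩
  -- Minimal and maximal elements confine `y` to `[-B, B]`; coordinates in `C` are differences of
  -- two values of `y`.
  refine ⟨2 * B, fun x hx p => ?_⟩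
  obtain ⟨y, m, hm, hy, hmono, hmark⟩ := M.exists_monotone_transfer hCO hmin hx
  have hyB : ∀ q, |y q| ≤ B := fun q => by
    obtain ⟨a, haq, ha⟩ := exists_isMin_le q
    obtain ⟨b, hqb, hb⟩ := exists_isMax_ge q
    have h1 := hmono haq
    have h2 := hmono hqb
    rw [hmark ⟨a, hmin a ha⟩] at h1
    rw [hmark ⟨b, hmax b hb⟩] at h2
    exact abs_le.2 ⟨(abs_le.1 (hB' _)).1.trans h1, h2.trans (abs_le.1 (hB' _)).2⟩
  rw [← hy]
  by_cases hp : p ∈ C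
  · rw [inverseTransfer_of_mem hp]
    linarith [abs_sub (y p) (y (m p)), hyB p, hyB (m p)]
  · rw [inverseTransfer_of_notMem hp]
    linarith [abs_nonneg (y p), hyB p]

/-! ### Integrality of the polytope -/

open Classical in
/-- Extend a point of `ℝ^P̃` by the values of the marking. -/
noncomputable def extend (M : MarkedPoset P) (w : M.Unmarked → ℝ) : P → ℝ :=
  fun p => if h : p ∈ M.marked then M.marking ⟨p, h⟩ else w ⟨p, h⟩

theorem extend_marked (w : M.Unmarked → ℝ) (a : M.marked) : M.extend w a = M.marking a :=
  dif_pos a.2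

theorem extend_unmarked (w : M.Unmarked → ℝ) (p : M.Unmarked) : M.extend w p = w p :=
  dif_neg p.2

theorem extend_restrict (hx : ∀ a : M.marked, x a = M.marking a) :
    M.extend (fun p => x p) = x := funext fun p => by
  by_cases hp : p ∈ M.marked
  · rw [M.extend_marked _ ⟨p, hp⟩, ← hx]
  · exact M.extend_unmarked _ ⟨p, hp⟩

theorem mem_chainOrderPolytope_iff {w : M.Unmarked → ℝ} :
    w ∈ M.chainOrderPolytope C O ↔ M.extend w ∈ M.chainOrderPolyhedron C O := by
  constructor
  · rintro ⟨x, hx, rfl⟩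
    rwa [M.extend_restrict hx.1]
  · intro h
    exact ⟨_, h, funext fun p => M.extend_unmarked w p⟩

theorem convex_chainOrderPolytope : Convex ℝ (M.chainOrderPolytope C O) := by
  have hsum : ∀ (l : List P) (x z : P → ℝ) (a b : ℝ),
      (l.map (a • x + b • z)).sum = a * (l.map x).sum + b * (l.map z).sum := by
    intro l x z a b
    induction l with
    | nil => simp
    | cons c l ih =>
      simp only [List.map_cons, List.sum_cons, ih, Pi.add_apply, Pi.smul_apply, smul_eq_mul]
      ring
  have hconv : Convex ℝ (M.chainOrderPolyhedron C O) := by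
    intro x hx z hz a b ha hb hab
    refine ⟨fun p => ?_, fun p hp => ?_, fun p q l hp hq hl hch => ?_⟩
    · simp only [Pi.add_apply, Pi.smul_apply, smul_eq_mul, hx.1, hz.1]
      rw [← add_mul, hab, one_mul]
    · have h1 := mul_nonneg ha (hx.2.1 p hp)
      have h2 := mul_nonneg hb (hz.2.1 p hp)
      simpa using add_nonneg h1 h2
    · have h1 := mul_le_mul_of_nonneg_left (hx.2.2 p q l hp hq hl hch) ha
      have h2 := mul_le_mul_of_nonneg_left (hz.2.2 p q l hp hq hl hch) hb
      rw [hsum]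
      simp only [Pi.add_apply, Pi.smul_apply, smul_eq_mul]
      linarith
  exact hconv.is_linear_image (f := fun (x : P → ℝ) (p : M.Unmarked) => x p)
    ⟨fun _ _ => rfl, fun _ _ => rfl⟩

-- For fixed `m` the inverse transfer is linear in `y`. Rounding by `⌊· + t⌋` is monotone, so the
-- same `m` still selects maximal lower covers and averaging over `t` commutes with the transfer.
open MeasureTheory in
theorem chainOrderPolytope_eq_convexHull [Finite P] (hCO : ∀ p, p ∉ C ↔ p ∈ M.marked ∪ O)
    (hmin : ∀ p : P, IsMin p → p ∈ M.marked) (hmax : ∀ p : P, IsMax p → p ∈ M.marked)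
    (hint : M.IsIntegral) :
    M.chainOrderPolytope C O =
      convexHull ℝ (M.chainOrderPolytope C O ∩ latticePoints M.Unmarked) := by
  have := Fintype.ofFinite M.Unmarked
  obtain ⟨B, hB⟩ := M.exists_forall_abs_le hCO hmin hmax
  have hfin : (M.chainOrderPolytope C O ∩ latticePoints M.Unmarked).Finite := by
    refine finite_latticePoints_inter (B := B) ?_
    rintro _ ⟨x, hx, rfl⟩ i
    exact hB x hx i
  apply Set.Subset.antisymm
  · rintro _ ⟨x, hx, rfl⟩
    obtain ⟨y, m, hm, hy, hmono, hmark⟩ := M.exists_monotone_transfer hCO hmin hx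
    let g : ℝ → P → ℝ := fun t p => ((⌊y p + t⌋ : ℤ) : ℝ)
    let z : ℝ → M.Unmarked → ℝ := fun t p => inverseTransfer C m (g t) p
    let μ : Measure ℝ := volume.restrict (Set.Ioc 0 1)
    have : IsProbabilityMeasure μ := ⟨by simp [μ]⟩
    have hgint : ∀ p, Integrable (fun t => g t p) μ := fun p => by
      have h : Monotone fun t => g t p := fun s t hst =>
        Int.cast_le.2 (Int.floor_mono (by linarith))
      exact (h.intervalIntegrable (μ := volume) (a := 0) (b := 1)).1
    have hgval : ∀ p, ∫ t, g t p ∂μ = y p := fun p => by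
      rw [← integral_floor_add (y p), intervalIntegral.integral_of_le zero_le_one]
    have hz : ∀ p : M.Unmarked, Integrable (fun t => z t p) μ ∧ ∫ t, z t p ∂μ = x p := fun p => by
      rw [← hy]
      by_cases hp : (p : P) ∈ C
      · simp only [z, inverseTransfer_of_mem hp]
        exact ⟨(hgint _).sub (hgint _), by rw [integral_sub (hgint _) (hgint _), hgval, hgval]⟩
      · simp only [z, inverseTransfer_of_notMem hp]
        exact ⟨hgint _, hgval _⟩
    have hzmem : ∀ t ∈ Set.Ico (0 : ℝ) 1,
        z t ∈ M.chainOrderPolytope C O ∩ latticePoints M.Unmarked := fun t ht => by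
      refine ⟨⟨_, M.inverseTransfer_mem hCO (y := g t) (m := m) ?_ ?_ ?_, rfl⟩, fun p => ?_⟩
      · exact fun p hp => ⟨(hm p hp).1, fun q hq =>
          Int.cast_le.2 (Int.floor_mono (by linarith [(hm p hp).2 q hq]))⟩
      · exact fun p q hpq => Int.cast_le.2 (Int.floor_mono (by linarith [hmono hpq]))
      · intro a
        obtain ⟨n, hn⟩ := hint a
        simp only [g, hmark, hn, Int.floor_intCast_add, Int.floor_eq_zero_iff.2 ht, add_zero]
      · by_cases hp : (p : P) ∈ C
        · exact ⟨⌊y p + t⌋ - ⌊y (m p) + t⌋, by simp [z, g, inverseTransfer_of_mem hp]⟩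
        · exact ⟨⌊y p + t⌋, by simp [z, g, inverseTransfer_of_notMem hp]⟩
    have hmem := (convex_convexHull ℝ _).integral_mem (hfin.isClosed_convexHull ℝ) (μ := μ) (f := z)
      ?_ (Integrable.of_eval fun p => (hz p).1)
    · convert hmem using 1
      funext p
      rw [eval_integral fun p => (hz p).1, (hz p).2]
    -- At `t = 1` the rounding would raise the integral marking by one.
    · have hne : ∀ᵐ t ∂μ, t ≠ 1 := by
        refine ae_restrict_of_ae ?_
        simp [ae_iff]
      filter_upwards [ae_restrict_mem measurableSet_Ioc, hne] with t ht ht1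
      exact subset_convexHull ℝ _ (hzmem t ⟨ht.1.le, lt_of_le_of_ne ht.2 ht1⟩)
  · exact convexHull_min Set.inter_subset_left M.convex_chainOrderPolytope

end MarkedPoset

/-! ### Ranked markings give reflexive polytopes -/

namespace MarkedPoset

variable {P : Type*} [PartialOrder P] {M : MarkedPoset P} {C O : Set P}

open Classical in
/-- The linear coordinate at `p`, which vanishes if `p` is marked. -/
noncomputable def coord (M : MarkedPoset P) (p : P) : Module.Dual ℝ (M.Unmarked → ℝ) :=
  if h : p ∈ M.marked then 0 else LinearMap.proj (⟨p, h⟩ : M.Unmarked)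

theorem coord_marked {p : P} (hp : p ∈ M.marked) : M.coord p = 0 := dif_pos hp

theorem coord_unmarked (p : M.Unmarked) (w : M.Unmarked → ℝ) : M.coord p w = w p := by
  rw [coord, dif_neg p.2]
  rfl

theorem coord_mem_dualLatticePoints (p : P) : M.coord p ∈ dualLatticePoints M.Unmarked := by
  by_cases hp : p ∈ M.marked
  · rw [coord_marked hp]
    exact dualLatticePoints.zero_mem _
  · intro x hx
    obtain ⟨n, hn⟩ := hx ⟨p, hp⟩
    exact ⟨n, by rw [M.coord_unmarked ⟨p, hp⟩, hn]⟩

theorem extend_add (u w : M.Unmarked → ℝ) (p : P) :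
    M.extend (u + w) p = M.extend u p + M.coord p w := by
  by_cases hp : p ∈ M.marked
  · rw [M.extend_marked _ ⟨p, hp⟩, M.extend_marked _ ⟨p, hp⟩, coord_marked hp]
    simp
  · rw [M.extend_unmarked _ ⟨p, hp⟩, M.extend_unmarked _ ⟨p, hp⟩, M.coord_unmarked ⟨p, hp⟩]
    rfl

theorem sum_extend_add (u w : M.Unmarked → ℝ) (l : List P) :
    (l.map (M.extend (u + w))).sum = (l.map (M.extend u)).sum + (l.map M.coord).sum w := by
  induction l with
  | nil => simp
  | cons c l ih =>
    simp only [List.map_cons, List.sum_cons, ih, extend_add, LinearMap.add_apply]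
    ring

theorem sum_coord_mem_dualLatticePoints (l : List P) :
    (l.map M.coord).sum ∈ dualLatticePoints M.Unmarked := by
  induction l with
  | nil => exact dualLatticePoints.zero_mem _
  | cons c l ih =>
    rw [List.map_cons, List.sum_cons]
    exact dualLatticePoints.add_mem (coord_mem_dualLatticePoints c) ih

/-- The saturated chains `a ⋖ p₁ ⋖ ⋯ ⋖ pₖ ⋖ b` that give the inequalities of the chain-order
polyhedron, as triples of `a`, `b` and the list of the `pᵢ`. -/
def saturatedChains (M : MarkedPoset P) (C O : Set P) : Set (P × P × List P) :=
  {t | t.1 ∈ M.marked ∪ O ∧ t.2.1 ∈ M.marked ∪ O ∧ (∀ p ∈ t.2.2, p ∈ C) ∧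
    List.IsChain (fun p q => p ⋖ q) (t.1 :: (t.2.2 ++ [t.2.1]))}

theorem finite_saturatedChains [Finite P] : (M.saturatedChains C O).Finite := by
  classical
  have := Fintype.ofFinite P
  have hnodup : {l : List P | l.Nodup}.Finite :=
    @Set.toFinite _ {l : List P | l.Nodup} (inferInstanceAs (Finite {l : List P // l.Nodup}))
  refine (Set.finite_univ.prod (Set.finite_univ.prod hnodup)).subset ?_
  rintro ⟨a, b, l⟩ ⟨-, -, -, h⟩
  refine ⟨trivial, trivial, ?_⟩
  have hlt : List.IsChain (fun p q : P => p < q) (a :: (l ++ [b])) :=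
    h.imp fun p q hpq => hpq.lt
  have hnd : (a :: (l ++ [b])).Nodup := hlt.pairwise.imp fun h => h.ne
  exact (List.nodup_append.1 (List.nodup_cons.1 hnd).2).1

/-- The linear parts of the inequalities that define the chain-order polytope. -/
def constraints (M : MarkedPoset P) (C O : Set P) : Set (Module.Dual ℝ (M.Unmarked → ℝ)) :=
  (fun p => -M.coord p) '' C ∪
    (fun t => (t.2.2.map M.coord).sum + M.coord t.1 - M.coord t.2.1) '' M.saturatedChains C O

theorem finite_constraints [Finite P] : (M.constraints C O).Finite :=
  ((Set.toFinite C).image _).union (finite_saturatedChains.image _)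

theorem constraints_subset_dualLatticePoints :
    M.constraints C O ⊆ dualLatticePoints M.Unmarked := by
  rintro _ (⟨p, -, rfl⟩ | ⟨t, -, rfl⟩)
  · exact dualLatticePoints.neg_mem (coord_mem_dualLatticePoints p)
  · simp only [sub_eq_add_neg]
    exact dualLatticePoints.add_mem (dualLatticePoints.add_mem (sum_coord_mem_dualLatticePoints _)
      (coord_mem_dualLatticePoints _)) (dualLatticePoints.neg_mem (coord_mem_dualLatticePoints _))

open Classical in
/-- The point with coordinate `1` on `C` and the rank elsewhere. -/
noncomputable def rankPoint (M : MarkedPoset P) (C : Set P) (r : P → ℤ) : M.Unmarked → ℝ :=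
  fun p => if (p : P) ∈ C then 1 else (r p : ℝ)

theorem rankPoint_mem_latticePoints (r : P → ℤ) :
    M.rankPoint C r ∈ latticePoints M.Unmarked := fun p => by
  by_cases hp : (p : P) ∈ C
  · exact ⟨1, by simp [rankPoint, hp]⟩
  · exact ⟨r p, by simp [rankPoint, hp]⟩

theorem rank_eq_add_length {r : P → ℤ} (hr : IsRankFunction r) (a b : P) (l : List P)
    (h : List.IsChain (fun p q => p ⋖ q) (a :: (l ++ [b]))) : r b = r a + l.length + 1 := by
  induction l generalizing a with
  | nil =>
    have := hr a b (by simpa using h)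
    simp
    lia
  | cons c l ih =>
    rw [List.cons_append, List.isChain_cons_cons] at h
    have h1 := hr a c h.1
    have h2 := ih c h.2
    simp only [List.length_cons, Nat.cast_add, Nat.cast_one]
    lia

/-- The slack at the rank point is `1 - 0` for `0 ≤ x p`, and `r b - r a - l.length = 1` for a
chain. -/
theorem image_sub_rankPoint (hCO : ∀ p, p ∉ C ↔ p ∈ M.marked ∪ O) {r : P → ℤ}
    (hr : IsRankFunction r) (hmark : ∀ a : M.marked, M.marking a = (r a : ℝ)) :
    (fun x => x - M.rankPoint C r) '' M.chainOrderPolytope C O =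
      unitPolyhedron (M.constraints C O) := by
  have hC : ∀ p ∈ C, M.extend (M.rankPoint C r) p = 1 := fun p hp => by
    have hpm : p ∉ M.marked := fun h => (hCO p).2 (Or.inl h) hp
    rw [M.extend_unmarked _ ⟨p, hpm⟩, rankPoint, if_pos hp]
  have hO : ∀ p, p ∉ C → M.extend (M.rankPoint C r) p = r p := fun p hp => by
    by_cases hpm : p ∈ M.marked
    · rw [M.extend_marked _ ⟨p, hpm⟩, hmark]
    · rw [M.extend_unmarked _ ⟨p, hpm⟩, rankPoint, if_neg hp]
  have hsum : ∀ l : List P, (∀ p ∈ l, p ∈ C) →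
      (l.map (M.extend (M.rankPoint C r))).sum = l.length := fun l hl => by
    rw [List.map_congr_left (g := fun _ => (1 : ℝ)) fun p hp => hC p (hl p hp)]
    simp
  have hchain : ∀ a b l w, a ∈ M.marked ∪ O → b ∈ M.marked ∪ O → (∀ p ∈ l, p ∈ C) →
      List.IsChain (fun p q => p ⋖ q) (a :: (l ++ [b])) →
      ((l.map (M.extend (M.rankPoint C r + w))).sum ≤
        M.extend (M.rankPoint C r + w) b - M.extend (M.rankPoint C r + w) a ↔
      ((l.map M.coord).sum + M.coord a - M.coord b) w ≤ 1) := by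
    intro a b l w ha hb hl hch
    have hrank : (r b : ℝ) = r a + l.length + 1 := by
      exact_mod_cast rank_eq_add_length hr a b l hch
    rw [sum_extend_add, extend_add, extend_add, hsum l hl, hO a ((hCO a).2 ha),
      hO b ((hCO b).2 hb), hrank, LinearMap.sub_apply, LinearMap.add_apply]
    constructor <;> intro h <;> linarith
  have key : ∀ w, M.rankPoint C r + w ∈ M.chainOrderPolytope C O ↔
      w ∈ unitPolyhedron (M.constraints C O) := by
    intro w
    rw [mem_chainOrderPolytope_iff]
    constructor
    · rintro ⟨-, h2, h3⟩ _ (⟨p, hp, rfl⟩ | ⟨t, ht, rfl⟩)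
      · have h := h2 p hp
        rw [extend_add, hC p hp] at h
        rw [LinearMap.neg_apply]
        linarith
      · exact (hchain _ _ _ w ht.1 ht.2.1 ht.2.2.1 ht.2.2.2).1
          (h3 _ _ _ ht.1 ht.2.1 ht.2.2.1 ht.2.2.2)
    · intro h
      refine ⟨M.extend_marked _, fun p hp => ?_, fun a b l ha hb hl hch => ?_⟩
      · have h1 := h _ (Or.inl ⟨p, hp, rfl⟩)
        rw [LinearMap.neg_apply] at h1
        rw [extend_add, hC p hp]
        linarith
      · exact (hchain a b l w ha hb hl hch).2 (h _ (Or.inr ⟨(a, b, l), ⟨ha, hb, hl, hch⟩, rfl⟩))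
  ext w
  rw [← key]
  constructor
  · rintro ⟨x, hx, rfl⟩
    simpa using hx
  · intro h
    exact ⟨_, h, by simp⟩

theorem reflexive_of_isRankFunction [Finite P] (hmin : ∀ p : P, IsMin p → p ∈ M.marked)
    (hmax : ∀ p : P, IsMax p → p ∈ M.marked) (hint : M.IsIntegral) {r : P → ℤ}
    (hr : IsRankFunction r) (hmark : ∀ a : M.marked, M.marking a = (r a : ℝ))
    (hCO : ∀ p, p ∉ C ↔ p ∈ M.marked ∪ O) :
    interior (M.chainOrderPolytope C O) ∩ latticePoints M.Unmarked = {M.rankPoint C r} ∧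
      IsReflexivePolytope ((fun x => x - M.rankPoint C r) '' M.chainOrderPolytope C O) := by
  obtain ⟨B, hB⟩ := M.exists_forall_abs_le hCO hmin hmax
  refine isReflexivePolytope_of_image_sub_eq finite_constraints
    constraints_subset_dualLatticePoints (rankPoint_mem_latticePoints r)
    (image_sub_rankPoint hCO hr hmark) (B := B) ?_
    (M.chainOrderPolytope_eq_convexHull hCO hmin hmax hint)
  rintro _ ⟨x, hx, rfl⟩ i
  exact hB x hx i

end MarkedPoset

/-! ### Strict extensions and facets of the order polytope -/

/-- A strictly monotone function on a subset of a finite preorder `R` whose elements bound every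
element from below and from above extends to a function strictly monotone with respect to `R`. -/
theorem exists_strict_extension {P : Type*} [Finite P] {R : P → P → Prop} (hrefl : ∀ s, R s s)
    (htrans : ∀ s t v, R s t → R t v → R s v) {A : Set P} {f : A → ℝ}
    (hf : ∀ a b : A, R a b → a = b ∨ f a < f b) (hlower : ∀ s, ∃ a : A, R a s)
    (hupper : ∀ s, ∃ b : A, R s b) :
    ∃ z : P → ℝ, (∀ a : A, z a = f a) ∧ (∀ s t, R s t → z s ≤ z t) ∧
      ∀ s t, R s t → ¬ R t s → z s < z t := by
  have hf' : ∀ a b : A, R a b → f a ≤ f b := fun a b h =>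
    (hf a b h).elim (fun h => h ▸ le_rfl) le_of_lt
  have hlo : ∀ s, ∃ a : A, R a s ∧ ∀ a' : A, R a' s → f a' ≤ f a := fun s => by
    obtain ⟨a, ha, h⟩ := Set.exists_max_image {a : A | R a s} f (Set.toFinite _) (hlower s)
    exact ⟨a, ha, h⟩
  have hhi : ∀ s, ∃ b : A, R s b ∧ ∀ b' : A, R s b' → f b ≤ f b' := fun s => by
    obtain ⟨b, hb, h⟩ := Set.exists_min_image {b : A | R s b} f (Set.toFinite _) (hupper s)
    exact ⟨b, hb, h⟩
  choose lo hlo hlomax using hlo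
  choose hi hhi himin using hhi
  -- The weight for interpolating between the bounds `f (lo s)` and `f (hi s)`. It grows strictly
  -- along `R`, and the `+ 1` keeps it below `1`.
  let τ : P → ℝ := fun s => ({t | R t s}.ncard : ℝ) / (Nat.card P + 1)
  have hcard : (0 : ℝ) < Nat.card P + 1 := by positivity
  have hτ0 : ∀ s, 0 ≤ τ s := fun s => by positivity
  have hτ1 : ∀ s, τ s < 1 := fun s => by
    rw [div_lt_one hcard]
    exact_mod_cast Nat.lt_succ_of_le (Set.ncard_le_card _)
  have hτmono : ∀ s t, R s t → τ s ≤ τ t := fun s t hst => by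
    refine div_le_div_of_nonneg_right ?_ hcard.le
    exact_mod_cast Set.ncard_le_ncard (fun v hv => htrans _ _ _ hv hst) (Set.toFinite _)
  have hτstrict : ∀ s t, R s t → ¬ R t s → τ s < τ t := fun s t hst hts => by
    refine div_lt_div_of_pos_right ?_ hcard
    have hss : {v | R v s} ⊂ {v | R v t} :=
      ⟨fun v hv => htrans _ _ _ hv hst, fun h => hts (h (hrefl t))⟩
    exact_mod_cast Set.ncard_lt_ncard hss (Set.toFinite _)
  have hlohi : ∀ s, f (lo s) ≤ f (hi s) := fun s => hf' _ _ (htrans _ _ _ (hlo s) (hhi s))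
  have hlomono : ∀ s t, R s t → f (lo s) ≤ f (lo t) := fun s t hst =>
    hlomax t _ (htrans _ _ _ (hlo s) hst)
  have himono : ∀ s t, R s t → f (hi s) ≤ f (hi t) := fun s t hst =>
    himin s _ (htrans _ _ _ hst (hhi t))
  have hstep : ∀ s t, R s t → f (lo s) + τ s * (f (hi s) - f (lo s)) ≤
      f (lo t) + τ s * (f (hi t) - f (lo t)) := fun s t hst => by
    have h1 := mul_le_mul_of_nonneg_left (hlomono s t hst) (sub_nonneg.2 (hτ1 s).le)
    have h2 := mul_le_mul_of_nonneg_left (himono s t hst) (hτ0 s)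
    linarith
  refine ⟨fun s => f (lo s) + τ s * (f (hi s) - f (lo s)), fun a => ?_, fun s t hst => ?_,
    fun s t hst hts => ?_⟩
  · have h1 : f (lo a) = f a := le_antisymm (hf' _ _ (hlo a)) (hlomax a a (hrefl a))
    have h2 : f (hi a) = f a := le_antisymm (himin a a (hrefl a)) (hf' _ _ (hhi a))
    simp [h1, h2]
  · refine (hstep s t hst).trans ?_
    have := mul_le_mul_of_nonneg_right (hτmono s t hst) (sub_nonneg.2 (hlohi t))
    linarith
  · rcases (hlohi t).lt_or_eq with hlt | heq
    · refine (hstep s t hst).trans_lt ?_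
      have := mul_lt_mul_of_pos_right (hτstrict s t hst hts) (sub_pos.2 hlt)
      linarith
    -- Here `t` is `R`-equivalent to a marked element, so the increase must come from the lower
    -- bound, whose weight `1 - τ s` is positive.
    · have heq' : lo t = hi t :=
        (hf _ _ (htrans _ _ _ (hlo t) (hhi t))).resolve_right (by rw [heq]; exact lt_irrefl _)
      have hlos : f (lo s) < f (hi t) := by
        refine (hf _ _ (htrans _ _ _ (htrans _ _ _ (hlo s) hst) (hhi t))).resolve_left fun h => ?_
        exact hts (htrans _ _ _ (hhi t) (h ▸ hlo s))
      have h1 := mul_lt_mul_of_pos_left hlos (sub_pos.2 (hτ1 s))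
      have h2 := mul_le_mul_of_nonneg_left (himono s t hst) (hτ0 s)
      simp only [heq, sub_self, mul_zero, add_zero]
      linarith

theorem exists_pos_smul_mem_of_zero_mem_interior {ι : Type*} {A : Set (ι → ℝ)}
    (hA : 0 ∈ interior A) (d : ι → ℝ) : ∃ ε : ℝ, 0 < ε ∧ ε • d ∈ A := by
  have hcont : Filter.Tendsto (fun t : ℝ => t • d) (nhds 0) (nhds 0) := by
    simpa using (Continuous.tendsto (f := fun t : ℝ => t • d) (by fun_prop) 0)
  have hev : ∀ᶠ t in nhdsWithin (0 : ℝ) (Set.Ioi 0), t • d ∈ A :=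
    (hcont.eventually (mem_interior_iff_mem_nhds.1 hA)).filter_mono nhdsWithin_le_nhds
  obtain ⟨t, htd, ht⟩ := (hev.and self_mem_nhdsWithin).exists
  exact ⟨t, ht, htd⟩

namespace MarkedPoset

variable {P : Type*} [PartialOrder P] {M : MarkedPoset P}

theorem mem_chainOrderPolyhedron_empty {x : P → ℝ} :
    x ∈ M.chainOrderPolyhedron ∅ M.markedᶜ ↔
      (∀ a : M.marked, x a = M.marking a) ∧ ∀ p q : P, p ⋖ q → x p ≤ x q := by
  constructor
  · rintro ⟨h1, -, h3⟩
    refine ⟨h1, fun p q hpq => ?_⟩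
    have h := h3 p q [] (by simp) (by simp) (by simp) (by simpa using hpq)
    simpa using h
  · rintro ⟨h1, h2⟩
    refine ⟨h1, fun p hp => hp.elim, fun a b l _ _ hl hch => ?_⟩
    obtain rfl : l = [] := List.eq_nil_iff_forall_not_mem.2 hl
    simpa using h2 a b (by simpa using hch)

theorem not_covBy_of_marked (hreg : M.IsRegular) {p q : P} (hp : p ∈ M.marked)
    (hq : q ∈ M.marked) : ¬ p ⋖ q := fun hpq => by
  -- Regularity with the roles of the ends interchanged contradicts monotonicity.
  rcases hreg p q hpq ⟨q, hq⟩ ⟨p, hp⟩ le_rfl le_rfl with h | h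
  · exact hpq.ne (congrArg Subtype.val h).symm
  · exact absurd (M.monotone_marking (show (⟨p, hp⟩ : M.marked) ≤ ⟨q, hq⟩ from hpq.le)) (not_le.2 h)

/-- For a regular marking, each covering relation defines a facet of the marked order polytope: it
has a point at which the inequality of this relation is tight, and all others are strict. -/
theorem exists_tight_only_at [Finite P] (hmin : ∀ p : P, IsMin p → p ∈ M.marked)
    (hmax : ∀ p : P, IsMax p → p ∈ M.marked) (hreg : M.IsRegular) {p q : P} (hpq : p ⋖ q) :
    ∃ z : P → ℝ, (∀ a : M.marked, z a = M.marking a) ∧ z p = z q ∧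
      ∀ s t : P, s ⋖ t → z s < z t ∨ (s = p ∧ t = q) := by
  -- The preorder generated by `≤` and `q ≤ p`: it identifies `p` with `q`, and regularity makes the
  -- marking strict on it.
  let R : P → P → Prop := fun s t => s ≤ t ∨ (s ≤ q ∧ p ≤ t)
  have hR : ∀ s t, s ≤ t → R s t := fun s t => Or.inl
  have htrans : ∀ s t v, R s t → R t v → R s v := by
    rintro s t v (h1 | h1) (h2 | h2)
    · exact Or.inl (h1.trans h2)
    · exact Or.inr ⟨h1.trans h2.1, h2.2⟩
    · exact Or.inr ⟨h1.1, h1.2.trans h2⟩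
    · exact Or.inr ⟨h1.1, h2.2⟩
  have hmarking : ∀ a b : M.marked, R a b → a = b ∨ M.marking a < M.marking b := by
    rintro a b (h | h)
    · rcases h.eq_or_lt with h | h
      · exact Or.inl (Subtype.ext h)
      · obtain ⟨c, hac, -⟩ := exists_covBy_le_of_lt h
        exact hreg a c hac a b hac.le h.le
    · exact hreg p q hpq a b h.1 h.2
  have hlower : ∀ s, ∃ a : M.marked, R a s := fun s => by
    obtain ⟨a, has, ha⟩ := exists_isMin_le s
    exact ⟨⟨a, hmin a ha⟩, hR _ _ has⟩
  have hupper : ∀ s, ∃ b : M.marked, R s b := fun s => by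
    obtain ⟨b, hsb, hb⟩ := exists_isMax_ge s
    exact ⟨⟨b, hmax b hb⟩, hR _ _ hsb⟩
  obtain ⟨z, hmark, hmono, hstrict⟩ :=
    exists_strict_extension (fun s => hR s s le_rfl) htrans hmarking hlower hupper
  refine ⟨z, hmark, le_antisymm (hmono _ _ (hR _ _ hpq.le)) (hmono _ _ (Or.inr ⟨le_rfl, le_rfl⟩)),
    fun s t hst => ?_⟩
  by_cases hts : R t s
  -- Now `p ≤ s < t ≤ q`, and nothing lies strictly between `p` and `q`.
  · obtain ⟨htq, hps⟩ := hts.resolve_left hst.lt.not_ge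
    have hsp : s = p := by
      by_contra hne
      exact hpq.2 (lt_of_le_of_ne hps (Ne.symm hne)) (hst.lt.trans_le htq)
    have hqt : t = q := by
      by_contra hne
      exact hpq.2 (hps.trans_lt hst.lt) (lt_of_le_of_ne htq hne)
    exact Or.inr ⟨hsp, hqt⟩
  · exact Or.inl (hstrict s t (hR _ _ hst.le) hts)

/-! ### Reflexivity forces a rank function -/

/-- If the translate of the marked order polytope by a lattice point is reflexive, then this point
has lattice distance `1` from every facet. -/
theorem sub_eq_one_of_reflexive [Finite P] (hmin : ∀ p : P, IsMin p → p ∈ M.marked)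
    (hmax : ∀ p : P, IsMax p → p ∈ M.marked) (hreg : M.IsRegular) (hint : M.IsIntegral)
    {u : M.Unmarked → ℝ} (hul : u ∈ latticePoints M.Unmarked)
    (hrefl : IsReflexivePolytope ((fun x => x - u) '' M.chainOrderPolytope ∅ M.markedᶜ))
    {p q : P} (hpq : p ⋖ q) : M.extend u q - M.extend u p = 1 := by
  classical
  have := Fintype.ofFinite M.Unmarked
  obtain ⟨h0, -, S, -, hSl, hS⟩ := hrefl
  have hA : ∀ w, w ∈ (fun x => x - u) '' M.chainOrderPolytope ∅ M.markedᶜ ↔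
      ∀ s t : P, s ⋖ t →
        M.extend u s + M.coord s w ≤ M.extend u t + M.coord t w := fun w => by
    have : w ∈ (fun x => x - u) '' M.chainOrderPolytope ∅ M.markedᶜ ↔
        u + w ∈ M.chainOrderPolytope ∅ M.markedᶜ :=
      ⟨by rintro ⟨x, hx, rfl⟩; simpa using hx, fun h => ⟨_, h, by simp⟩⟩
    rw [this, mem_chainOrderPolytope_iff, mem_chainOrderPolyhedron_empty,
      and_iff_right (M.extend_marked _)]
    simp only [extend_add]
  obtain ⟨c, hc⟩ : ∃ c : ℤ, M.extend u q - M.extend u p = c := by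
    have hex : ∀ s, ∃ n : ℤ, M.extend u s = n := fun s => by
      by_cases hs : s ∈ M.marked
      · rw [M.extend_marked u ⟨s, hs⟩]
        exact hint _
      · rw [M.extend_unmarked u ⟨s, hs⟩]
        exact hul _
    obtain ⟨m, hm⟩ := hex p
    obtain ⟨n, hn⟩ := hex q
    exact ⟨n - m, by simp [hm, hn]⟩
  set β : Module.Dual ℝ (M.Unmarked → ℝ) := M.coord p - M.coord q with hβ
  have hβle : ∀ w ∈ (fun x => x - u) '' M.chainOrderPolytope ∅ M.markedᶜ, β w ≤ c := fun w hw => by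
    have h := (hA w).1 hw p q hpq
    rw [hβ, LinearMap.sub_apply]
    linarith
  -- an integral direction in which the inequality of `p ⋖ q` increases by one
  obtain ⟨d, hdl, hd⟩ : ∃ d ∈ latticePoints M.Unmarked, β d = 1 := by
    by_cases hp : p ∈ M.marked
    · have hq : q ∉ M.marked := fun hq => not_covBy_of_marked hreg hp hq hpq
      refine ⟨Pi.single ⟨q, hq⟩ (-1), fun i => ?_, ?_⟩
      · by_cases hi : i = ⟨q, hq⟩
        · exact ⟨-1, by simp [hi]⟩
        · exact ⟨0, by simp [hi]⟩
      · rw [hβ, LinearMap.sub_apply, coord_marked hp, M.coord_unmarked ⟨q, hq⟩]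
        simp
    · refine ⟨Pi.single ⟨p, hp⟩ 1, fun i => ?_, ?_⟩
      · by_cases hi : i = ⟨p, hp⟩
        · exact ⟨1, by simp [hi]⟩
        · exact ⟨0, by simp [hi]⟩
      · rw [hβ, LinearMap.sub_apply, M.coord_unmarked ⟨p, hp⟩, Pi.single_eq_same]
        by_cases hq : q ∈ M.marked
        · rw [coord_marked hq]
          simp
        · rw [M.coord_unmarked ⟨q, hq⟩, Pi.single_eq_of_ne]
          · simp
          · exact fun h => hpq.ne (congrArg Subtype.val h).symm
  have hcpos : (0 : ℝ) < c := by
    obtain ⟨ε, hε, hmem⟩ := exists_pos_smul_mem_of_zero_mem_interior h0 d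
    have h := hβle _ hmem
    rw [map_smul, hd, smul_eq_mul, mul_one] at h
    exact hε.trans_le h
  obtain ⟨z, hzm, hzpq, hzlt⟩ := exists_tight_only_at hmin hmax hreg hpq
  set w : M.Unmarked → ℝ := (fun s : M.Unmarked => z s) - u with hw
  have hzw : ∀ s, M.extend u s + M.coord s w = z s := fun s => by
    rw [← extend_add, hw, add_sub_cancel, M.extend_restrict hzm]
  have hwA : w ∈ (fun x => x - u) '' M.chainOrderPolytope ∅ M.markedᶜ := (hA w).2 fun s t hst => by
    rw [hzw, hzw]
    rcases hzlt s t hst with h | ⟨rfl, rfl⟩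
    · exact h.le
    · exact hzpq.le
  have hβw : β w = c := by
    have h1 := hzw p
    have h2 := hzw q
    rw [hβ, LinearMap.sub_apply, ← hc]
    linarith
  -- a vertex of the dual polytope that attains its maximum at `w`
  obtain ⟨α, hαS, hαw⟩ : ∃ α ∈ S, 1 ≤ α w := by
    by_contra! hlt
    have hmem : (c : ℝ)⁻¹ • β ∈ convexHull ℝ S := by
      rw [← hS]
      intro v hv
      rw [LinearMap.smul_apply, smul_eq_mul, inv_mul_le_iff₀ hcpos, mul_one]
      exact hβle v hv
    have hsub : convexHull ℝ S ⊆ {γ | γ w < 1} :=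
      convexHull_min hlt
        (convex_halfSpace_lt (f := fun γ : Module.Dual ℝ (M.Unmarked → ℝ) => γ w)
          ⟨fun _ _ => rfl, fun _ _ => rfl⟩ 1)
    have h : ((c : ℝ)⁻¹ • β) w < 1 := hsub hmem
    rw [LinearMap.smul_apply, smul_eq_mul, hβw, inv_mul_cancel₀ hcpos.ne'] at h
    exact lt_irrefl _ h
  have hαle : ∀ v ∈ (fun x => x - u) '' M.chainOrderPolytope ∅ M.markedᶜ, α v ≤ 1 := by
    have : α ∈ polarDual ((fun x => x - u) '' M.chainOrderPolytope ∅ M.markedᶜ) := by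
      rw [hS]
      exact subset_convexHull ℝ S hαS
    exact this
  -- A small step from `w` along `v` preserves the other inequalities, strict at `w`, and leaves
  -- that of `p ⋖ q` tight. It stays in the polytope, where `α ≤ 1 ≤ α w`.
  have hker : ∀ v, β v = 0 → α v ≤ 0 := fun v hv => by
    have hev : ∀ᶠ ε in nhdsWithin (0 : ℝ) (Set.Ioi 0), ∀ t : P × P, t.1 ⋖ t.2 →
        z t.1 + ε * M.coord t.1 v ≤ z t.2 + ε * M.coord t.2 v := by
      refine Filter.eventually_all.2 fun t => ?_
      by_cases ht : t.1 ⋖ t.2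
      · rcases hzlt _ _ ht with h | ⟨h1, h2⟩
        · have hopen : IsOpen {ε : ℝ | z t.1 + ε * M.coord t.1 v < z t.2 + ε * M.coord t.2 v} :=
            isOpen_lt (by fun_prop) (by fun_prop)
          filter_upwards [nhdsWithin_le_nhds (hopen.mem_nhds (by simpa using h))] with ε hε _
          exact le_of_lt hε
        · refine Filter.Eventually.of_forall fun ε _ => ?_
          rw [h1, h2, hzpq]
          rw [hβ, LinearMap.sub_apply] at hv
          rw [sub_eq_zero.1 hv]
      · exact Filter.Eventually.of_forall fun ε h => absurd h ht
    obtain ⟨ε, hε, hpos⟩ := (hev.and self_mem_nhdsWithin).exists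
    have hpos : 0 < ε := hpos
    have hmem : w + ε • v ∈ (fun x => x - u) '' M.chainOrderPolytope ∅ M.markedᶜ :=
      (hA _).2 fun s t hst => by
        have h := hε (s, t) hst
        rw [map_add, map_add, map_smul, map_smul, ← add_assoc, ← add_assoc, hzw, hzw]
        exact h
    have h := hαle _ hmem
    rw [map_add, map_smul, smul_eq_mul] at h
    by_contra! hneg
    linarith [mul_pos hpos hneg]
  -- Applying `hker` to both signs shows that `α` vanishes at `w - c • d`, which lies in the kernel
  -- of `β`.
  have hαβ : α w = c * α d := by
    have hv : β (w - (c : ℝ) • d) = 0 := by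
      rw [map_sub, map_smul, hβw, hd, smul_eq_mul, mul_one, sub_self]
    have h1 := hker _ hv
    have h2 := hker (-(w - (c : ℝ) • d)) (by rw [map_neg, hv, neg_zero])
    rw [map_neg] at h2
    have h3 : α (w - (c : ℝ) • d) = 0 := by linarith
    rw [map_sub, map_smul, smul_eq_mul] at h3
    linarith
  obtain ⟨n, hn⟩ := hSl hαS d hdl
  have hone : c * n = 1 := by
    have h : (c : ℝ) * n = 1 := by
      rw [← hn, ← hαβ]
      exact le_antisymm (hαle w hwA) hαw
    exact_mod_cast h
  have hc1 : c = 1 := Int.eq_one_of_mul_eq_one_right (by exact_mod_cast hcpos.le) hone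
  rw [hc, hc1, Int.cast_one]

theorem exists_isRankFunction_of_reflexive [Finite P] (hmin : ∀ p : P, IsMin p → p ∈ M.marked)
    (hmax : ∀ p : P, IsMax p → p ∈ M.marked) (hreg : M.IsRegular) (hint : M.IsIntegral)
    {u : M.Unmarked → ℝ} (hul : u ∈ latticePoints M.Unmarked)
    (hrefl : IsReflexivePolytope ((fun x => x - u) '' M.chainOrderPolytope ∅ M.markedᶜ)) :
    ∃ r : P → ℤ, IsRankFunction r ∧ ∀ a : M.marked, M.marking a = (r a : ℝ) := by
  have hex : ∀ s, ∃ n : ℤ, M.extend u s = n := fun s => by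
    by_cases hs : s ∈ M.marked
    · rw [M.extend_marked u ⟨s, hs⟩]
      exact hint _
    · rw [M.extend_unmarked u ⟨s, hs⟩]
      exact hul _
  choose r hr using hex
  refine ⟨r, fun p q hpq => ?_, fun a => by rw [← hr, M.extend_marked]⟩
  have h := sub_eq_one_of_reflexive hmin hmax hreg hint hul hrefl hpq
  rw [hr, hr] at h
  have h' : r q - r p = 1 := by exact_mod_cast h
  lia

end MarkedPoset

theorem mainTheorem1 {P : Type*} [PartialOrder P] [Finite P] (M : MarkedPoset P)
    (hmin : ∀ p : P, IsMin p → p ∈ M.marked) (hmax : ∀ p : P, IsMax p → p ∈ M.marked)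
    (hint : M.IsIntegral) (hreg : M.IsRegular) :
    (∃ r : P → ℤ, IsRankFunction r ∧ ∀ a : M.marked, M.marking a = (r a : ℝ)) ↔
    (∀ C O : Set P, Disjoint C O → C ∪ O = M.markedᶜ →
      ∃ u : M.Unmarked → ℝ,
        interior (M.chainOrderPolytope C O) ∩ latticePoints M.Unmarked = {u} ∧
        IsReflexivePolytope (Set.image (fun x => x - u) (M.chainOrderPolytope C O))) := by
  constructor
  · rintro ⟨r, hr, hmark⟩ C O hdisj hunion
    refine ⟨M.rankPoint C r,
      M.reflexive_of_isRankFunction hmin hmax hint hr hmark fun p => ⟨fun hp => ?_, ?_⟩⟩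
    · by_cases hpm : p ∈ M.marked
      · exact Or.inl hpm
      · have h : p ∈ C ∪ O := hunion ▸ hpm
        exact Or.inr (h.resolve_left hp)
    · rintro (hp | hp) hpC
      · have h : p ∈ M.markedᶜ := hunion ▸ Or.inl hpC
        exact h hp
      · exact Set.disjoint_left.1 hdisj hpC hp
  · intro h
    -- The order polytope alone already determines the rank function.
    obtain ⟨u, hu, hrefl⟩ := h ∅ M.markedᶜ (Set.empty_disjoint _) (Set.empty_union _)
    have hul : u ∈ latticePoints M.Unmarked := by
      have : u ∈ ({u} : Set (M.Unmarked → ℝ)) := rfl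
      rw [← hu] at this
      exact this.2
    exact M.exists_isRankFunction_of_reflexive hmin hmax hreg hint hul hrefl
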